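/- **Domains.** A subset of a poset is directed if it is nonempty and any two of its elements have an upper bound in it. In a poset $D$ write $x\ll y$ if for every directed $S\subseteq D$ having a least upper bound $\bigsqcup S$ with $y\sqsubseteq\bigsqcup S$ there is $w\in S$ with $x\sqsubseteq w$. A subset $B\subseteq D$ is a basis if for every $x\in D$ the set $\{b\in B: b\ll x\}$ contains a directed set with least upper bound $x$. A domain is a poset in which every directed subset has a least upper bound and which has a basis. $\mathbf{DOM}$ is the category of domains and Scott continuous functions (functions preserving all existing least upper bounds of directed sets). $\mathbf{DOM}_b$ is the category of pairs (domain, designated basis) with all Scott continuous functions between the underlying domains as morphisms. **Information frames.** An information frame is a set $A$ with, for each $i\in A$, a family $\mathrm{Con}_i$ of finite subsets of $A$ and a relation $\vdash_i\subseteq \mathrm{Con}_i\times A$, such that, writing $X\vdash_i Y$ for $\forall b\in Y\; X\vdash_i b$ and $iRj$ for $\{i\}\in\mathrm{Con}_j$, for all $i,j,a\in A$ and finite $X,Y\subseteq A$: (1) $\{i\}\in\mathrm{Con}_i$; (2) $Y\subseteq X\in\mathrm{Con}_i\Rightarrow Y\in\mathrm{Con}_i$; (3) $X\in\mathrm{Con}_i\wedge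 X\vdash_iY\Rightarrow Y\in\mathrm{Con}_i$; (4) $X,Y\in\mathrm{Con}_i\wedge X\subseteq Y\wedge X\vdash_i a\Rightarrow Y\vdash_i a$; (5) $X\in\mathrm{Con}_i\wedge X\vdash_i Y\wedge Y\vdash_i a\Rightarrow X\vdash_i a$; (6) $iRj\Rightarrow\mathrm{Con}_i\subseteq\mathrm{Con}_j$; (7) $iRj\wedge X\in\mathrm{Con}_i\wedge X\vdash_ia\Rightarrow X\vdash_ja$; (8) if $X\in\mathrm{Con}_i$ and $X\vdash_iY$, then there are $e\in A$ and $Z\in\mathrm{Con}_e$ with $X\vdash_i\{e\}\cup Z$ and $Z\vdash_eY$. An approximable mapping $H:A\to A'$ is a family of relations $H_i\subseteq\mathrm{Con}_i\times A'$ $(i\in A)$ such that, writing $XH_iY$ for $\forall c\in Y\;XH_ic$, for all $i,j\in A$, $X,X'\in\mathrm{Con}_i$, $b,k\in A'$, $Y\in\bigcup_{p\in A'}\mathrm{Con}'_p$ and finite $F\subseteq A'$: (1) $XH_i(\{k\}\cup Y)\wedge Y\vdash'_kb\Rightarrow XH_ib$; (2) $X\subseteq X'\wedge XH_ib\Rightarrow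 X'H_ib$; (3) $X\vdash_iX'\wedge X'H_ib\Rightarrow XH_ib$; (4) $iRj\wedge XH_ib\Rightarrow XH_jb$; (5) if $XH_iF$, there are $c\in A$, $e\in A'$, $U\in\mathrm{Con}_c$, $V\in\mathrm{Con}'_e$ with $X\vdash_i\{c\}\cup U$, $UH_c(\{e\}\cup V)$ and $V\vdash'_eF$. The identity on $A$ is $(\vdash_i)_{i\in A}$; the composite of $G:A\to A'$ followed by $H:A'\to A''$ relates $X\in\mathrm{Con}_i$ to $a$ iff there are $e\in A'$, $V\in\mathrm{Con}'_e$ with $XG_i(\{e\}\cup V)$ and $VH_ea$. This gives the category $\mathbf{INF}$. **The functors.** A state of $A$ is a set $x\subseteq A$ such that: every finite $F\subseteq x$ lies in $\mathrm{Con}_i$ for some $i\in x$; if $i\in x$, $X\subseteq x$, $X\in\mathrm{Con}_i$ and $X\vdash_ia$, then $a\in x$; and for every $a\in x$ there are $i\in x$ and $X\subseteq x$ with $X\in\mathrm{Con}_i$ and $X\vdash_ia$. $\mathcal D(A)$ is the domain $|A|$ of all states ordered by inclusion, with the canonical basis of all states $[X]_i=\{a: X\vdash_ia\}$, $i\in A$,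 $X\in\mathrm{Con}_i$; and $\mathcal D(H)(x)=\{a:\exists i\,\exists X\in\mathrm{Con}_i,\ \{i\}\cup X\subseteq x\wedge XH_ia\}$. For a domain $D$ with basis $B$, $\mathcal F(D)$ is the information frame with token set $B$, $\mathrm{CON}_i=\{\{i\}\}\cup\{X\subseteq B\text{ finite}: b\ll i\ \forall b\in X\}$ and $X\vDash_ia\iff\exists b\in X\cup\{i\},\ a\ll b$ (for $X\in\mathrm{CON}_i$); and for $f:D\to D'$, $X\,\mathcal F(f)_i\,a\iff\exists c\in X\cup\{i\},\ a\ll' f(c)$ (for $X\in\mathrm{CON}_i$). **Theorem.** The categories $\mathbf{DOM}$ and $\mathbf{INF}$ are equivalent. More precisely: (i) $\mathcal F:\mathbf{DOM}_b\to\mathbf{INF}$ and $\mathcal D:\mathbf{INF}\to\mathbf{DOM}_b$ are functors forming an equivalence of categories; there is a natural isomorphism $\eta:\mathrm{Id}_{\mathbf{INF}}\Rightarrow\mathcal F\circ\mathcal D$ with $X(\eta_A)_iv\iff v\ll[X]_i$ for all $i\in A$, $X\in\mathrm{Con}_i$ and $v$ in the canonical basis of $|A|$, and a natural isomorphism $\tau:\mathrm{Id}_{\mathbf{DOM}_b}\Rightarrow\mathcal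 D\circ\mathcal F$ with $\tau_D(x)=\{a\in B: a\ll x\}$. (ii) For every choice of a basis $B_D$ of each domain $D$, the functor $\mathcal F:\mathbf{DOM}\to\mathbf{INF}$ formed with these bases and the functor $\mathcal D:\mathbf{INF}\to\mathbf{DOM}$ (forgetting the canonical basis) form an equivalence of categories, and there are natural isomorphisms $\eta:\mathrm{Id}_{\mathbf{INF}}\Rightarrow\mathcal F\circ\mathcal D$ and $\tau:\mathrm{Id}_{\mathbf{DOM}}\Rightarrow\mathcal D\circ\mathcal F$ given by the same formulas, with $v\in B_{|A|}$ and $a\in B_D$ respectively. -/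

import Mathlib

open CategoryTheory

universe u

/-! ## Domains -/

/-- Every directed (in particular nonempty) subset has a least upper bound. -/
def DirectedComplete (D : Type u) [PartialOrder D] : Prop :=
  ∀ S : Set D, S.Nonempty → DirectedOn (· ≤ ·) S → ∃ s, IsLUB S s

/-- The approximation (way-below) relation `x ≪ y` of a poset. -/
def Approximates {D : Type u} [PartialOrder D] (x y : D) : Prop :=
  ∀ S : Set D, S.Nonempty → DirectedOn (· ≤ ·) S → ∀ s, IsLUB S s → y ≤ s → ∃ w ∈ S, x ≤ w

/-- `B` is a basis of the poset `D`: for every `x`, the set of all `b ∈ B` with `b ≪ x`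
contains a directed subset whose least upper bound is `x`. -/
def IsDomainBasis {D : Type u} [PartialOrder D] (B : Set D) : Prop :=
  ∀ x : D, ∃ S : Set D, S ⊆ {b | b ∈ B ∧ Approximates b x} ∧
    S.Nonempty ∧ DirectedOn (· ≤ ·) S ∧ IsLUB S x

/-- A (continuous) domain: a directed-complete partial order that has a basis. -/
structure DOM : Type (u + 1) where
  carrier : Type u
  [order : PartialOrder carrier]
  directedComplete : DirectedComplete carrier
  exists_basis : ∃ B : Set carrier, IsDomainBasis B

attribute [instance] DOM.order

/-- Scott continuous functions between domains. -/
@[ext] structure ScottMap (D E : DOM.{u}) : Type u where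
  toFun : D.carrier → E.carrier
  scott : ScottContinuous toFun

theorem scottContinuous_comp' {α β γ : Type u} [PartialOrder α] [PartialOrder β] [PartialOrder γ]
    {f : α → β} {g : β → γ} (hf : ScottContinuous f) (hg : ScottContinuous g) :
    ScottContinuous (fun x => g (f x)) := by
  intro S hS hd a ha
  have h1 := hf hS hd ha
  have h2 := hg (hS.image f)
    (by
      rintro _ ⟨x, hx, rfl⟩ _ ⟨y, hy, rfl⟩
      obtain ⟨z, hz, hxz, hyz⟩ := hd x hx y hy
      exact ⟨f z, ⟨z, hz, rfl⟩, hf.monotone hxz, hf.monotone hyz⟩) h1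
  rwa [Set.image_image] at h2

/-- The category **DOM** of domains and Scott continuous functions. -/
instance : Category DOM.{u} where
  Hom := ScottMap
  id D := ⟨fun x => x, fun S _ _ a ha => by simpa using ha⟩
  comp f g := ⟨fun x => g.toFun (f.toFun x), scottContinuous_comp' f.scott g.scott⟩

/-- A domain together with a designated basis. -/
structure BasedDOM : Type (u + 1) where
  toDOM : DOM.{u}
  basis : Set toDOM.carrier
  isBasis : IsDomainBasis basis

/-- Morphisms of domains with designated bases are all Scott continuous functions between the
underlying domains; the bases play no role for them. -/
instance : Category BasedDOM.{u} where
  Hom D E := ScottMap D.toDOM E.toDOM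
  id D := 𝟙 D.toDOM
  comp {D E F} f g := (show D.toDOM ⟶ E.toDOM from f) ≫ (show E.toDOM ⟶ F.toDOM from g)

/-- The functor forgetting the designated basis. -/
def BasedDOM.forgetBasis : BasedDOM.{u} ⥤ DOM.{u} where
  obj D := D.toDOM
  map f := f

/-- A choice of a basis for every domain. -/
structure BasisChoice : Type (u + 1) where
  basis : (D : DOM.{u}) → Set D.carrier
  isBasis : ∀ D, IsDomainBasis (basis D)

/-- The functor equipping every domain with its chosen basis. -/
def BasisChoice.equip (𝓑 : BasisChoice.{u}) : DOM.{u} ⥤ BasedDOM.{u} where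
  obj D := ⟨D, 𝓑.basis D, 𝓑.isBasis D⟩
  map f := f

/-! ## Information frames -/

/-- Information frames. `Con i` is a family of finite sets of tokens and `Ent i` is the entailment
relation `⊢ᵢ ⊆ Con i × A`. For a set `Y` of tokens, `X ⊢ᵢ Y` is written out as
`∀ b ∈ Y, Ent i X b`, and the accessibility relation `i R j` as `{i} ∈ Con j`. -/
structure InformationFrame : Type (u + 1) where
  carrier : Type u
  Con : carrier → Set (Set carrier)
  Ent : carrier → Set carrier → carrier → Prop
  con_finite : ∀ {i : carrier} {X : Set carrier}, X ∈ Con i → X.Finite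
  con_of_ent : ∀ {i : carrier} {X : Set carrier} {a : carrier}, Ent i X a → X ∈ Con i
  self_consistency : ∀ i, {i} ∈ Con i
  consistency_preservation : ∀ {i : carrier} {X Y : Set carrier}, Y ⊆ X → X ∈ Con i → Y ∈ Con i
  soundness : ∀ {i : carrier} {X Y : Set carrier},
    Y.Finite → X ∈ Con i → (∀ b ∈ Y, Ent i X b) → Y ∈ Con i
  weakening : ∀ {i : carrier} {X Y : Set carrier} {a : carrier},
    X ∈ Con i → Y ∈ Con i → X ⊆ Y → Ent i X a → Ent i Y a
  cut : ∀ {i : carrier} {X Y : Set carrier} {a : carrier},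
    X ∈ Con i → (∀ b ∈ Y, Ent i X b) → Ent i Y a → Ent i X a
  consistency_transfer : ∀ {i j : carrier}, {i} ∈ Con j → Con i ⊆ Con j
  entailment_transfer : ∀ {i j : carrier} {X : Set carrier} {a : carrier},
    {i} ∈ Con j → X ∈ Con i → Ent i X a → Ent j X a
  interpolation : ∀ {i : carrier} {X Y : Set carrier},
    X ∈ Con i → Y.Finite → (∀ b ∈ Y, Ent i X b) →
    ∃ e : carrier, ∃ Z ∈ Con e, (∀ b ∈ {e} ∪ Z, Ent i X b) ∧ ∀ b ∈ Y, Ent e Z b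

/-- Approximable mappings between information frames: families of relations
`Hᵢ ⊆ Con i × A'`, with the same conventions as for entailment. -/
@[ext] structure ApproximableMapping (A A' : InformationFrame.{u}) : Type u where
  rel : A.carrier → Set A.carrier → A'.carrier → Prop
  con_of_rel : ∀ {i : A.carrier} {X : Set A.carrier} {b : A'.carrier}, rel i X b → X ∈ A.Con i
  ent_right : ∀ {i : A.carrier} {X : Set A.carrier} {k : A'.carrier}
    {Y : Set A'.carrier} {b : A'.carrier},
    X ∈ A.Con i → (∀ c ∈ {k} ∪ Y, rel i X c) → A'.Ent k Y b → rel i X b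
  weakening : ∀ {i : A.carrier} {X X' : Set A.carrier} {b : A'.carrier},
    X ∈ A.Con i → X' ∈ A.Con i → X ⊆ X' → rel i X b → rel i X' b
  ent_left : ∀ {i : A.carrier} {X X' : Set A.carrier} {b : A'.carrier},
    X ∈ A.Con i → X' ∈ A.Con i → (∀ c ∈ X', A.Ent i X c) →
    rel i X' b → rel i X b
  transfer : ∀ {i j : A.carrier} {X : Set A.carrier} {b : A'.carrier},
    {i} ∈ A.Con j → X ∈ A.Con i → rel i X b → rel j X b
  interpolation : ∀ {i : A.carrier} {X : Set A.carrier} {F : Set A'.carrier},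
    X ∈ A.Con i → F.Finite → (∀ b ∈ F, rel i X b) →
    ∃ (c : A.carrier) (e : A'.carrier), ∃ U ∈ A.Con c, ∃ V ∈ A'.Con e,
      (∀ b ∈ {c} ∪ U, A.Ent i X b) ∧ (∀ b ∈ {e} ∪ V, rel c U b) ∧ ∀ b ∈ F, A'.Ent e V b

namespace InformationFrame

variable {A : InformationFrame.{u}}

theorem strong_cut {i j : A.carrier} {X Y : Set A.carrier} {a : A.carrier} (hX : X ∈ A.Con i)
    (h : ∀ b ∈ {j} ∪ Y, A.Ent i X b) (hY : A.Ent j Y a) : A.Ent i X a := by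
  have hji : {j} ∈ A.Con i := A.soundness (Set.finite_singleton j) hX
    (fun b hb => h b (Or.inl hb))
  exact A.cut hX (fun b hb => h b (Or.inr hb))
    (A.entailment_transfer hji (A.con_of_ent hY) hY)

end InformationFrame

namespace ApproximableMapping

variable {A A' A'' : InformationFrame.{u}}

theorem strong_left (H : ApproximableMapping A A') {i j : A.carrier} {X Y : Set A.carrier}
    {b : A'.carrier} (hX : X ∈ A.Con i) (h : ∀ c ∈ {j} ∪ Y, A.Ent i X c) (hY : H.rel j Y b) :
    H.rel i X b := by
  have hji : {j} ∈ A.Con i := A.soundness (Set.finite_singleton j) hX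
    (fun b hb => h b (Or.inl hb))
  exact H.ent_left hX (A.consistency_transfer hji (H.con_of_rel hY))
    (fun b hb => h b (Or.inr hb)) (H.transfer hji (H.con_of_rel hY) hY)

theorem interp_left (H : ApproximableMapping A A') {i : A.carrier} {X : Set A.carrier}
    {F : Set A'.carrier} (hX : X ∈ A.Con i) (hF : F.Finite) (h : ∀ b ∈ F, H.rel i X b) :
    ∃ c, ∃ U ∈ A.Con c, (∀ b ∈ {c} ∪ U, A.Ent i X b) ∧ ∀ b ∈ F, H.rel c U b := by
  obtain ⟨c, e, U, hU, V, hV, h1, h2, h3⟩ := H.interpolation hX hF h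
  exact ⟨c, U, hU, h1, fun b hb => H.ent_right hU h2 (h3 b hb)⟩

theorem interp_right (H : ApproximableMapping A A') {i : A.carrier} {X : Set A.carrier}
    {F : Set A'.carrier} (hX : X ∈ A.Con i) (hF : F.Finite) (h : ∀ b ∈ F, H.rel i X b) :
    ∃ e, ∃ V ∈ A'.Con e, (∀ b ∈ {e} ∪ V, H.rel i X b) ∧ ∀ b ∈ F, A'.Ent e V b := by
  obtain ⟨c, e, U, hU, V, hV, h1, h2, h3⟩ := H.interpolation hX hF h
  exact ⟨e, V, hV, fun b hb => H.strong_left hX h1 (h2 b hb), h3⟩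

/-- Finitely many witnesses of a composition can be replaced by a single one. -/
theorem compose_witness (G : ApproximableMapping A A') (H : ApproximableMapping A' A'')
    {i : A.carrier} {X : Set A.carrier} (hX : X ∈ A.Con i) {F : Set A''.carrier} (hF : F.Finite)
    (hc : ∀ c ∈ F, ∃ e, ∃ V ∈ A'.Con e, (∀ b ∈ {e} ∪ V, G.rel i X b) ∧ H.rel e V c) :
    ∃ e, ∃ V ∈ A'.Con e, (∀ b ∈ {e} ∪ V, G.rel i X b) ∧ ∀ c ∈ F, H.rel e V c := by
  choose e V hV hG hH using hc
  have hfin : (⋃ (c) (hc : c ∈ F), ({e c hc} ∪ V c hc)).Finite :=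
    hF.biUnion' (fun c hc => (Set.finite_singleton _).union (A'.con_finite (hV c hc)))
  obtain ⟨d, W, hW, h1, h2⟩ := G.interp_right hX hfin (by
    intro b hb
    simp only [Set.mem_iUnion] at hb
    obtain ⟨c, hc, hb⟩ := hb
    exact hG c hc b hb)
  refine ⟨d, W, hW, h1, fun c hc => H.strong_left hW (fun b hb => h2 b ?_) (hH c hc)⟩
  simp only [Set.mem_iUnion]
  exact ⟨c, hc, hb⟩

/-- The identity approximable mapping is the entailment relation. -/
def identity (A : InformationFrame.{u}) : ApproximableMapping A A where
  rel := A.Ent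
  con_of_rel := A.con_of_ent
  ent_right := A.strong_cut
  weakening := A.weakening
  ent_left hX _ h h' := A.cut hX h h'
  transfer := A.entailment_transfer
  interpolation hX hF h := by
    obtain ⟨e, Z, hZ, h1, h2⟩ := A.interpolation hX hF h
    obtain ⟨c, U, hU, h3, h4⟩ :=
      A.interpolation hX ((Set.finite_singleton e).union (A.con_finite hZ)) h1
    exact ⟨c, e, U, hU, Z, hZ, h3, h4, h2⟩

/-- Composition of approximable mappings, in diagrammatic order. -/
def compose (G : ApproximableMapping A A') (H : ApproximableMapping A' A'') :
    ApproximableMapping A A'' where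
  rel i X a := X ∈ A.Con i ∧ ∃ e, ∃ V ∈ A'.Con e, (∀ b ∈ {e} ∪ V, G.rel i X b) ∧ H.rel e V a
  con_of_rel h := h.1
  ent_right {i X k Y b} hX h hY := by
    refine ⟨hX, ?_⟩
    obtain ⟨e, V, hV, h1, h2⟩ := compose_witness G H hX
      ((Set.finite_singleton k).union (A''.con_finite (A''.con_of_ent hY))) (fun c hc => (h c hc).2)
    exact ⟨e, V, hV, h1, H.ent_right hV h2 hY⟩
  weakening hX hX' hs h := by
    obtain ⟨_, e, V, hV, h1, h2⟩ := h
    exact ⟨hX', e, V, hV, fun b hb => G.weakening hX hX' hs (h1 b hb), h2⟩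
  ent_left hX hX' hs h := by
    obtain ⟨_, e, V, hV, h1, h2⟩ := h
    exact ⟨hX, e, V, hV, fun b hb => G.ent_left hX hX' hs (h1 b hb), h2⟩
  transfer hij hX h := by
    obtain ⟨_, e, V, hV, h1, h2⟩ := h
    exact ⟨A.consistency_transfer hij hX, e, V, hV, fun b hb => G.transfer hij hX (h1 b hb), h2⟩
  interpolation {i X F} hX hF h := by
    obtain ⟨e, V, hV, h1, h2⟩ :=
      compose_witness G H hX hF (fun c hc => (h c hc).2)
    obtain ⟨c, U, hU, h3, h4⟩ :=
      G.interp_left hX ((Set.finite_singleton e).union (A'.con_finite hV)) h1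
    obtain ⟨e', V', hV', h5, h6⟩ := H.interp_right hV hF h2
    exact ⟨c, e', U, hU, V', hV', h3, fun b hb => ⟨hU, e, V, hV, h4, h5 b hb⟩, h6⟩

end ApproximableMapping

/-- The category **INF** of information frames and approximable mappings. -/
abbrev INF := InformationFrame.{u}

instance : Category INF.{u} where
  Hom := ApproximableMapping
  id := ApproximableMapping.identity
  comp := ApproximableMapping.compose
  id_comp {A A'} H := by
    apply ApproximableMapping.ext
    funext i X a
    apply propext
    constructor
    · rintro ⟨hX, e, V, hV, h1, h2⟩
      exact H.strong_left hX h1 h2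
    · intro h
      have hX := H.con_of_rel h
      obtain ⟨c, U, hU, h1, h2⟩ := H.interp_left (F := {a}) hX (Set.finite_singleton a)
        (by rintro b rfl; exact h)
      exact ⟨hX, c, U, hU, h1, h2 a rfl⟩
  comp_id {A A'} H := by
    apply ApproximableMapping.ext
    funext i X a
    apply propext
    constructor
    · rintro ⟨hX, e, V, hV, h1, h2⟩
      exact H.ent_right hX h1 h2
    · intro h
      have hX := H.con_of_rel h
      obtain ⟨c, U, hU, h1, h2⟩ := H.interp_right (F := {a}) hX (Set.finite_singleton a)
        (by rintro b rfl; exact h)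
      exact ⟨hX, c, U, hU, h1, h2 a rfl⟩
  assoc {A B C D} G H K := by
    apply ApproximableMapping.ext
    funext i X a
    apply propext
    constructor
    · rintro ⟨hX, e, V, hV, h1, h2⟩
      obtain ⟨f, T, hT, h7, h8⟩ := ApproximableMapping.compose_witness G H hX
        ((Set.finite_singleton e).union (C.con_finite hV)) (fun c hc => (h1 c hc).2)
      exact ⟨hX, f, T, hT, h7, hT, e, V, hV, h8, h2⟩
    · rintro ⟨hX, e, V, hV, h1, _, f, T, hT, h2, h3⟩
      exact ⟨hX, f, T, hT, fun b hb => ⟨hX, e, V, hV, h1, h2 b hb⟩, h3⟩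

/-! ## The state-domain functor -/

namespace InformationFrame

variable {A : InformationFrame.{u}}

/-- The (global) states of an information frame. -/
structure IsState (A : InformationFrame.{u}) (x : Set A.carrier) : Prop where
  finite_consistency : ∀ F : Set A.carrier, F.Finite → F ⊆ x → ∃ i ∈ x, F ∈ A.Con i
  closed : ∀ i ∈ x, ∀ X : Set A.carrier, X.Finite → X ⊆ x → ∀ a, X ∈ A.Con i → A.Ent i X a → a ∈ x
  complete : ∀ a ∈ x, ∃ i ∈ x, ∃ X : Set A.carrier, X.Finite ∧ X ⊆ x ∧ X ∈ A.Con i ∧ A.Ent i X a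

theorem IsState.entails {x : Set A.carrier} (hx : A.IsState x) {F : Set A.carrier}
    (hF : F.Finite) (hFx : F ⊆ x) :
    ∃ i ∈ x, ∃ X ∈ A.Con i, X ⊆ x ∧ ∀ b ∈ F, A.Ent i X b := by
  have hc : ∀ a ∈ F, ∃ i ∈ x, ∃ X : Set A.carrier, X.Finite ∧ X ⊆ x ∧ X ∈ A.Con i ∧ A.Ent i X a :=
    fun a ha => hx.complete a (hFx ha)
  choose i hi X hXf hXx hXc hE using hc
  have hfin : (⋃ (a) (ha : a ∈ F), ({i a ha} ∪ X a ha)).Finite :=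
    hF.biUnion' (fun c hc => (Set.finite_singleton _).union (hXf c hc))
  have hsub : (⋃ (a) (ha : a ∈ F), ({i a ha} ∪ X a ha)) ⊆ x := by
    intro b hb
    simp only [Set.mem_iUnion] at hb
    obtain ⟨c, hc, hb | hb⟩ := hb
    · rw [Set.mem_singleton_iff.1 hb]
      exact hi c hc
    · exact hXx c hc hb
  obtain ⟨j, hj, hcon⟩ := hx.finite_consistency _ hfin hsub
  refine ⟨j, hj, _, hcon, hsub, fun a ha => ?_⟩
  have hs : ∀ b ∈ ({i a ha} ∪ X a ha : Set A.carrier),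
      b ∈ (⋃ (a) (ha : a ∈ F), ({i a ha} ∪ X a ha)) := by
    intro b hb
    simp only [Set.mem_iUnion]
    exact ⟨a, ha, hb⟩
  have hij : {i a ha} ∈ A.Con j := A.consistency_preservation
    (fun b hb => hs b (Or.inl hb)) hcon
  have hXj := A.consistency_transfer hij (hXc a ha)
  exact A.weakening hXj hcon (fun b hb => hs b (Or.inr hb))
    (A.entailment_transfer hij (hXc a ha) (hE a ha))

/-- The set `[X]ᵢ` of all tokens entailed by a consistent set `X`. -/
def entailed (A : InformationFrame.{u}) (i : A.carrier) (X : Set A.carrier) : Set A.carrier :=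
  {a | A.Ent i X a}

theorem isState_entailed {i : A.carrier} {X : Set A.carrier} (hX : X ∈ A.Con i) :
    A.IsState (A.entailed i X) where
  finite_consistency F hF h := by
    obtain ⟨e, Z, hZ, h1, h2⟩ := A.interpolation hX hF h
    exact ⟨e, h1 e (Or.inl rfl), A.soundness hF hZ h2⟩
  closed j hj Y _ hYx a _ hE := by
    refine A.strong_cut hX (j := j) (Y := Y) ?_ hE
    rintro b (rfl | hb)
    · exact hj
    · exact hYx hb
  complete a ha := by
    obtain ⟨e, Z, hZ, h1, h2⟩ := A.interpolation (Y := {a}) hX (Set.finite_singleton a)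
      (by rintro b rfl; exact ha)
    exact ⟨e, h1 e (Or.inl rfl), Z, A.con_finite hZ, fun b hb => h1 b (Or.inr hb), hZ, h2 a rfl⟩

/-- The poset `|A|` of states, ordered by inclusion. -/
abbrev State (A : InformationFrame.{u}) : Type u := {x : Set A.carrier // A.IsState x}

/-- The state `[X]ᵢ`. -/
def basicState (A : InformationFrame.{u}) (i : A.carrier) (X : Set A.carrier)
    (hX : X ∈ A.Con i) : A.State := ⟨A.entailed i X, isState_entailed hX⟩

/-- The canonical basis of `|A|`, consisting of all states `[X]ᵢ` with `X ∈ Con i`. -/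
def canonicalBasis (A : InformationFrame.{u}) : Set A.State :=
  {z | ∃ i, ∃ X, ∃ hX : X ∈ A.Con i, z = A.basicState i X hX}

theorem finite_subset_of_directed {S : Set A.State} (hne : S.Nonempty)
    (hd : DirectedOn (· ≤ ·) S) {F : Set A.carrier} (hF : F.Finite)
    (h : ∀ a ∈ F, ∃ z ∈ S, a ∈ z.1) : ∃ z ∈ S, F ⊆ z.1 := by
  induction F, hF using Set.Finite.induction_on with
  | empty =>
    obtain ⟨z, hz⟩ := hne
    exact ⟨z, hz, Set.empty_subset _⟩
  | @insert a F _ _ ih =>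
    obtain ⟨z, hz, hFz⟩ := ih (fun b hb => h b (Set.mem_insert_of_mem _ hb))
    obtain ⟨w, hw, haw⟩ := h a (Set.mem_insert _ _)
    obtain ⟨v, hv, hzv, hwv⟩ := hd z hz w hw
    exact ⟨v, hv, Set.insert_subset (hwv haw) (hFz.trans hzv)⟩

theorem isState_union {S : Set A.State} (hne : S.Nonempty) (hd : DirectedOn (· ≤ ·) S) :
    A.IsState {a | ∃ z ∈ S, a ∈ z.1} where
  finite_consistency F hF h := by
    obtain ⟨z, hz, hFz⟩ := finite_subset_of_directed hne hd hF h
    obtain ⟨i, hi, hc⟩ := z.2.finite_consistency F hF hFz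
    exact ⟨i, ⟨z, hz, hi⟩, hc⟩
  closed i hi X hXf hX a hc hE := by
    obtain ⟨z, hz, hFz⟩ := finite_subset_of_directed hne hd (F := insert i X) (hXf.insert i)
      (by
        rintro b (rfl | hb)
        · exact hi
        · exact hX hb)
    exact ⟨z, hz, z.2.closed i (hFz (Set.mem_insert _ _)) X hXf
      ((Set.subset_insert _ _).trans hFz) a hc hE⟩
  complete a ha := by
    obtain ⟨z, hz, haz⟩ := ha
    obtain ⟨i, hi, X, hXf, hX, hc, hE⟩ := z.2.complete a haz
    exact ⟨i, ⟨z, hz, hi⟩, X, hXf, fun b hb => ⟨z, hz, hX hb⟩, hc, hE⟩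

theorem isLUB_union {S : Set A.State} (hne : S.Nonempty) (hd : DirectedOn (· ≤ ·) S) :
    IsLUB S (⟨{a | ∃ z ∈ S, a ∈ z.1}, isState_union hne hd⟩ : A.State) := by
  constructor
  · intro z hz a ha
    exact ⟨z, hz, ha⟩
  · intro w hw a ha
    obtain ⟨z, hz, ha⟩ := ha
    exact hw hz ha

theorem mem_of_isLUB {S : Set A.State} (hne : S.Nonempty) (hd : DirectedOn (· ≤ ·) S)
    {s : A.State} (hs : IsLUB S s) {a : A.carrier} (ha : a ∈ s.1) : ∃ z ∈ S, a ∈ z.1 :=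
  hs.2 (isLUB_union hne hd).1 ha

theorem approximates_of_subset {i : A.carrier} {X : Set A.carrier} (hX : X ∈ A.Con i)
    {z : A.State} (h : {i} ∪ X ⊆ z.1) : Approximates (A.basicState i X hX) z := by
  intro S hne hd s hs hzs
  obtain ⟨w, hw, hFw⟩ := finite_subset_of_directed hne hd
    ((Set.finite_singleton i).union (A.con_finite hX))
    (fun a ha => mem_of_isLUB hne hd hs (hzs (h ha)))
  exact ⟨w, hw, fun a ha => w.2.closed i (hFw (Or.inl rfl)) X (A.con_finite hX)
    (fun b hb => hFw (Or.inr hb)) a hX ha⟩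

theorem isDomainBasis_canonicalBasis (A : InformationFrame.{u}) :
    IsDomainBasis A.canonicalBasis := by
  intro z
  refine ⟨{w | ∃ i, ∃ X, ∃ hX : X ∈ A.Con i, {i} ∪ X ⊆ z.1 ∧ w = A.basicState i X hX},
    ?_, ?_, ?_, ?_, ?_⟩
  · rintro _ ⟨i, X, hX, hz, rfl⟩
    exact ⟨⟨i, X, hX, rfl⟩, approximates_of_subset hX hz⟩
  · obtain ⟨i, hi, hc⟩ := z.2.finite_consistency ∅ Set.finite_empty (Set.empty_subset _)
    refine ⟨_, i, ∅, hc, ?_, rfl⟩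
    rintro b (rfl | hb)
    · exact hi
    · exact hb.elim
  · rintro _ ⟨i, X, hX, hz, rfl⟩ _ ⟨j, Y, hY, hz', rfl⟩
    obtain ⟨k, hk, Z, hZ, hZz, hE⟩ := z.2.entails
      (((Set.finite_singleton i).union (A.con_finite hX)).union
        ((Set.finite_singleton j).union (A.con_finite hY))) (Set.union_subset hz hz')
    refine ⟨_, ⟨k, Z, hZ, ?_, rfl⟩, ?_, ?_⟩
    · rintro b (rfl | hb)
      · exact hk
      · exact hZz hb
    · intro a ha
      exact A.strong_cut hZ (fun b hb => hE b (Or.inl hb)) ha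
    · intro a ha
      exact A.strong_cut hZ (fun b hb => hE b (Or.inr hb)) ha
  · rintro _ ⟨i, X, hX, hz, rfl⟩
    intro a ha
    exact z.2.closed i (hz (Or.inl rfl)) X (A.con_finite hX) (fun b hb => hz (Or.inr hb)) a hX ha
  · intro w hw a ha
    obtain ⟨i, hi, X, hXf, hXz, hX, hE⟩ := z.2.complete a ha
    refine hw ⟨i, X, hX, ?_, rfl⟩ hE
    rintro b (rfl | hb)
    · exact hi
    · exact hXz hb

/-- The domain of states of an information frame, with its canonical basis. -/
def stateDomain (A : InformationFrame.{u}) : BasedDOM.{u} where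
  toDOM :=
    { carrier := A.State
      directedComplete := fun _ hne hd => ⟨_, isLUB_union hne hd⟩
      exists_basis := ⟨A.canonicalBasis, A.isDomainBasis_canonicalBasis⟩ }
  basis := A.canonicalBasis
  isBasis := A.isDomainBasis_canonicalBasis

end InformationFrame

namespace ApproximableMapping

variable {A A' A'' : InformationFrame.{u}}

/-- The image of a set of tokens under an approximable mapping. -/
def image (H : ApproximableMapping A A') (x : Set A.carrier) : Set A'.carrier :=
  {a | ∃ i, ∃ X ∈ A.Con i, {i} ∪ X ⊆ x ∧ H.rel i X a}

theorem image_mono (H : ApproximableMapping A A') {x y : Set A.carrier} (h : x ⊆ y) :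
    H.image x ⊆ H.image y := by
  rintro a ⟨i, X, hX, hx, hr⟩
  exact ⟨i, X, hX, hx.trans h, hr⟩

theorem image_witness (H : ApproximableMapping A A') {x : Set A.carrier} (hx : A.IsState x)
    {F : Set A'.carrier} (hF : F.Finite) (h : F ⊆ H.image x) :
    ∃ i, ∃ X ∈ A.Con i, {i} ∪ X ⊆ x ∧ ∀ b ∈ F, H.rel i X b := by
  have hc : ∀ a ∈ F, ∃ i, ∃ X ∈ A.Con i, {i} ∪ X ⊆ x ∧ H.rel i X a := fun a ha => h ha
  choose i X hX hXx hr using hc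
  have hfin : (⋃ (a) (ha : a ∈ F), ({i a ha} ∪ X a ha)).Finite :=
    hF.biUnion' (fun c hc => (Set.finite_singleton _).union (A.con_finite (hX c hc)))
  have hsub : (⋃ (a) (ha : a ∈ F), ({i a ha} ∪ X a ha)) ⊆ x := by
    intro b hb
    simp only [Set.mem_iUnion] at hb
    obtain ⟨c, hc, hb⟩ := hb
    exact hXx c hc hb
  obtain ⟨j, hj, Z, hZ, hZx, hE⟩ := hx.entails hfin hsub
  refine ⟨j, Z, hZ, ?_, fun a ha => H.strong_left hZ (fun b hb => hE b ?_) (hr a ha)⟩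
  · rintro b (rfl | hb)
    · exact hj
    · exact hZx hb
  · simp only [Set.mem_iUnion]
    exact ⟨a, ha, hb⟩

theorem isState_image (H : ApproximableMapping A A') {x : Set A.carrier} (hx : A.IsState x) :
    A'.IsState (H.image x) where
  finite_consistency F hF h := by
    obtain ⟨i, X, hX, hXx, hr⟩ := H.image_witness hx hF h
    obtain ⟨e, V, hV, h1, h2⟩ := H.interp_right hX hF hr
    exact ⟨e, ⟨i, X, hX, hXx, h1 e (Or.inl rfl)⟩, A'.soundness hF hV h2⟩
  closed j hj Y hYf hY a _ hE := by
    obtain ⟨i, X, hX, hXx, hr⟩ := H.image_witness hx ((Set.finite_singleton j).union hYf)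
      (Set.union_subset (Set.singleton_subset_iff.2 hj) hY)
    exact ⟨i, X, hX, hXx, H.ent_right hX hr hE⟩
  complete a ha := by
    obtain ⟨i, X, hX, hXx, hr⟩ := ha
    obtain ⟨e, V, hV, h1, h2⟩ := H.interp_right (F := {a}) hX (Set.finite_singleton a)
      (by rintro b rfl; exact hr)
    exact ⟨e, ⟨i, X, hX, hXx, h1 e (Or.inl rfl)⟩, V, A'.con_finite hV,
      fun b hb => ⟨i, X, hX, hXx, h1 b (Or.inr hb)⟩, hV, h2 a rfl⟩

/-- The Scott continuous function between state domains induced by an approximable mapping. -/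
def stateMap (H : ApproximableMapping A A') :
    ScottMap A.stateDomain.toDOM A'.stateDomain.toDOM where
  toFun := fun x : A.State => (⟨H.image x.1, H.isState_image x.2⟩ : A'.State)
  scott := by
    intro S hne hd s hs
    constructor
    · rintro _ ⟨z, hz, rfl⟩
      exact H.image_mono (hs.1 hz)
    · rintro w hw a ⟨i, X, hX, hXs, hr⟩
      obtain ⟨z, hz, hXz⟩ := InformationFrame.finite_subset_of_directed hne hd
        ((Set.finite_singleton i).union (A.con_finite hX))
        (fun b hb => InformationFrame.mem_of_isLUB hne hd hs (hXs hb))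
      exact hw ⟨z, hz, rfl⟩ ⟨i, X, hX, hXz, hr⟩

end ApproximableMapping

/-- The state-domain functor `𝒟`; the domain of states carries its canonical basis. -/
def stateFunctor : INF.{u} ⥤ BasedDOM.{u} where
  obj A := A.stateDomain
  map H := ApproximableMapping.stateMap H
  map_id A := by
    apply ScottMap.ext
    funext x
    apply Subtype.ext
    apply Set.Subset.antisymm
    · rintro a ⟨i, X, hX, hXx, hr⟩
      exact x.2.closed i (hXx (Or.inl rfl)) X (A.con_finite hX)
        (fun b hb => hXx (Or.inr hb)) a hX hr
    · intro a ha
      obtain ⟨i, hi, X, hXf, hXx, hX, hE⟩ := x.2.complete a ha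
      refine ⟨i, X, hX, ?_, hE⟩
      rintro b (rfl | hb)
      · exact hi
      · exact hXx hb
  map_comp {A B C} G H := by
    apply ScottMap.ext
    funext x
    apply Subtype.ext
    apply Set.Subset.antisymm
    · rintro a ⟨i, X, hX, hXx, _, e, V, hV, h1, h2⟩
      exact ⟨e, V, hV, fun b hb => ⟨i, X, hX, hXx, h1 b hb⟩, h2⟩
    · rintro a ⟨e, V, hV, hVx, h2⟩
      obtain ⟨i, X, hX, hXx, hr⟩ := ApproximableMapping.image_witness G x.2
        ((Set.finite_singleton e).union (B.con_finite hV)) hVx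
      exact ⟨i, X, hX, hXx, hX, e, V, hV, hr, h2⟩

/-! ## The basis-to-frame functor -/

section Approximation

variable {D E : Type u} [PartialOrder D] [PartialOrder E]

theorem Approximates.le {x y : D} (h : Approximates x y) : x ≤ y := by
  obtain ⟨w, hw, hxw⟩ := h {y} (Set.singleton_nonempty y)
    (by rintro _ rfl _ rfl; exact ⟨_, rfl, le_rfl, le_rfl⟩) y isLUB_singleton le_rfl
  rwa [Set.mem_singleton_iff.1 hw] at hxw

theorem Approximates.mono {u x y z : D} (hux : u ≤ x) (h : Approximates x y) (hyz : y ≤ z) :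
    Approximates u z := by
  intro S hne hd s hs hzs
  obtain ⟨w, hw, hxw⟩ := h S hne hd s hs (hyz.trans hzs)
  exact ⟨w, hw, hux.trans hxw⟩

theorem Approximates.interpolate {B : Set D} (hB : IsDomainBasis B)
    {x y : D} (h : Approximates x y) : ∃ b ∈ B, Approximates x b ∧ Approximates b y := by
  obtain ⟨S, hSB, hne, hd, hS⟩ := hB y
  -- the elements of `B` that approximate some member of `S`
  have key : ∃ T : Set D, T.Nonempty ∧ DirectedOn (· ≤ ·) T ∧ IsLUB T y ∧
      ∀ t ∈ T, ∃ s ∈ S, Approximates t s := by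
    refine ⟨{t | ∃ s ∈ S, Approximates t s}, ?_, ?_, ⟨?_, ?_⟩, fun t ht => ht⟩
    · obtain ⟨s, hs⟩ := hne
      obtain ⟨T, hTB, ⟨t, ht⟩, _, _⟩ := hB s
      exact ⟨t, s, hs, (hTB ht).2⟩
    · rintro t ⟨s, hs, hts⟩ t' ⟨s', hs', hts'⟩
      obtain ⟨r, hr, hsr, hsr'⟩ := hd s hs s' hs'
      obtain ⟨T, hTB, hTne, hTd, hT⟩ := hB r
      obtain ⟨v, hv, htv⟩ := hts T hTne hTd r hT hsr
      obtain ⟨v', hv', htv'⟩ := hts' T hTne hTd r hT hsr'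
      obtain ⟨w, hw, hvw, hvw'⟩ := hTd v hv v' hv'
      exact ⟨w, ⟨r, hr, (hTB hw).2⟩, htv.trans hvw, htv'.trans hvw'⟩
    · rintro t ⟨s, hs, hts⟩
      exact hts.le.trans (hS.1 hs)
    · intro w hw
      refine hS.2 fun s hs => ?_
      obtain ⟨T, hTB, _, _, hT⟩ := hB s
      exact hT.2 fun t ht => hw ⟨s, hs, (hTB ht).2⟩
  obtain ⟨T, hTne, hTd, hT, hTS⟩ := key
  obtain ⟨t, ht, hxt⟩ := h T hTne hTd y hT le_rfl
  obtain ⟨s, hs, hts⟩ := hTS t ht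
  exact ⟨s, (hSB hs).1, Approximates.mono hxt hts le_rfl, (hSB hs).2⟩

theorem approximates_image {B : Set D} {B' : Set E}
    (hB : IsDomainBasis B) (hB' : IsDomainBasis B') {f : D → E} (hf : ScottContinuous f)
    {x : D} {F : Set E} (hF : F.Finite) (h : ∀ a ∈ F, Approximates a (f x)) :
    ∃ d ∈ B, Approximates d x ∧ ∀ a ∈ F, Approximates a (f d) := by
  obtain ⟨S, hSB, hne, hd, hS⟩ := hB x
  have hdir : DirectedOn (· ≤ ·) (f '' S) := by
    rintro _ ⟨p, hp, rfl⟩ _ ⟨q, hq, rfl⟩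
    obtain ⟨r, hr, hpr, hqr⟩ := hd p hp q hq
    exact ⟨f r, ⟨r, hr, rfl⟩, hf.monotone hpr, hf.monotone hqr⟩
  have hlub := hf hne hd hS
  have key : ∃ d ∈ S, ∀ a ∈ F, Approximates a (f d) := by
    induction F, hF using Set.Finite.induction_on with
    | empty =>
      obtain ⟨d, hd⟩ := hne
      exact ⟨d, hd, fun a ha => ha.elim⟩
    | @insert a F _ _ ih =>
      obtain ⟨d, hdS, hdF⟩ := ih (fun b hb => h b (Set.mem_insert_of_mem _ hb))
      obtain ⟨a', _, haa', ha'⟩ := (h a (Set.mem_insert _ _)).interpolate hB'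
      obtain ⟨_, ⟨d', hd'S, rfl⟩, hd'⟩ := ha' _ (hne.image f) hdir _ hlub le_rfl
      obtain ⟨r, hr, hdr, hdr'⟩ := hd d hdS d' hd'S
      refine ⟨r, hr, ?_⟩
      rintro b (rfl | hb)
      · exact Approximates.mono le_rfl haa' (hd'.trans (hf.monotone hdr'))
      · exact Approximates.mono le_rfl (hdF b hb) (hf.monotone hdr)
  obtain ⟨d, hd, hdF⟩ := key
  exact ⟨d, (hSB hd).1, (hSB hd).2, hdF⟩

theorem scottContinuous_identity : ScottContinuous (fun x : D => x) := by
  intro S _ _ a ha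
  simpa using ha

end Approximation

namespace BasedDOM

variable {D E : BasedDOM.{u}}

/-- The consistency predicate on the basis of a domain: the set `{i}` and the finite sets of
basis elements approximating `i`. -/
def basisCon (D : BasedDOM.{u}) (i : D.basis) : Set (Set D.basis) :=
  {X | X = {i} ∨ X.Finite ∧ ∀ b ∈ X, Approximates b.1 i.1}

theorem le_of_basisCon {i : D.basis} {X : Set D.basis} (hX : X ∈ D.basisCon i)
    {b : D.basis} (hb : b ∈ X ∪ {i}) : b.1 ≤ i.1 := by
  rcases hb with hb | rfl
  · rcases hX with rfl | ⟨_, h⟩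
    · rw [Set.mem_singleton_iff.1 hb]
    · exact (h b hb).le
  · exact le_rfl

/-- The information frame of a domain with designated basis. -/
def frame (D : BasedDOM.{u}) : InformationFrame.{u} where
  carrier := D.basis
  Con := D.basisCon
  Ent i X a := X ∈ D.basisCon i ∧ ∃ b ∈ X ∪ {i}, Approximates a.1 b.1
  con_finite {i X} hX := by
    rcases hX with rfl | hX
    · exact Set.finite_singleton i
    · exact hX.1
  con_of_ent h := h.1
  self_consistency i := Or.inl rfl
  consistency_preservation {i X Y} hYX hX := by
    rcases hX with rfl | ⟨hf, hX⟩
    · rcases Set.subset_singleton_iff_eq.1 hYX with rfl | rfl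
      · exact Or.inr ⟨Set.finite_empty, fun b hb => hb.elim⟩
      · exact Or.inl rfl
    · exact Or.inr ⟨hf.subset hYX, fun b hb => hX b (hYX hb)⟩
  soundness {i X Y} hY _ h := Or.inr ⟨hY, fun b hb => by
    obtain ⟨hX, c, hc, hbc⟩ := h b hb
    exact Approximates.mono le_rfl hbc (le_of_basisCon hX hc)⟩
  weakening {i X Y a} _ hY hXY h := by
    obtain ⟨_, c, hc, hac⟩ := h
    exact ⟨hY, c, Set.union_subset_union_left _ hXY hc, hac⟩
  cut {i X Y a} hX h hY := by
    obtain ⟨hYc, c, hc, hac⟩ := hY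
    exact ⟨hX, i, Or.inr rfl, Approximates.mono le_rfl hac (le_of_basisCon hYc hc)⟩
  consistency_transfer {i j} hij X hX := by
    rcases hij with hij | ⟨_, hij⟩
    · rw [Set.singleton_eq_singleton_iff] at hij
      exact hij ▸ hX
    · refine Or.inr ⟨?_, fun b hb => ?_⟩
      · rcases hX with rfl | hX
        · exact Set.finite_singleton i
        · exact hX.1
      · exact Approximates.mono (le_of_basisCon hX (Or.inl hb)) (hij i rfl) le_rfl
  entailment_transfer {i j X a} hij hX h := by
    obtain ⟨_, c, hc, hac⟩ := h
    have hle : i.1 ≤ j.1 := le_of_basisCon hij (Or.inl rfl)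
    refine ⟨?_, j, Or.inr rfl,
      Approximates.mono le_rfl hac ((le_of_basisCon hX hc).trans hle)⟩
    rcases hij with hij | ⟨_, hij⟩
    · rw [Set.singleton_eq_singleton_iff] at hij
      exact hij ▸ hX
    · refine Or.inr ⟨?_, fun b hb => ?_⟩
      · rcases hX with rfl | hX
        · exact Set.finite_singleton i
        · exact hX.1
      · exact Approximates.mono (le_of_basisCon hX (Or.inl hb)) (hij i rfl) le_rfl
  interpolation {i X Y} hX hY h := by
    obtain ⟨e, heB, hei, hYe⟩ := approximates_image D.isBasis D.isBasis
      scottContinuous_identity (x := i.1) (hY.image Subtype.val) (by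
        rintro _ ⟨a, ha, rfl⟩
        obtain ⟨hX, c, hc, hac⟩ := h a ha
        exact Approximates.mono le_rfl hac (le_of_basisCon hX hc))
    refine ⟨⟨e, heB⟩, {⟨e, heB⟩}, Or.inl rfl, ?_, ?_⟩
    · rintro b (rfl | rfl) <;> exact ⟨hX, i, Or.inr rfl, hei⟩
    · intro b hb
      exact ⟨Or.inl rfl, ⟨e, heB⟩, Or.inr rfl, hYe b.1 ⟨b, hb, rfl⟩⟩

/-- The approximable mapping induced by a Scott continuous function. -/
def frameMap (f : ScottMap D.toDOM E.toDOM) : ApproximableMapping D.frame E.frame where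
  rel i X a := X ∈ D.basisCon i ∧ ∃ c ∈ X ∪ {i}, Approximates a.1 (f.toFun c.1)
  con_of_rel h := h.1
  ent_right {i X k Y b} hX h hY := by
    obtain ⟨hYc, d, hd, hbd⟩ := hY
    obtain ⟨_, c, hc, hdc⟩ := h d (Set.union_comm Y {k} ▸ hd)
    exact ⟨hX, c, hc, Approximates.mono le_rfl hbd hdc.le⟩
  weakening hX hX' hs h := by
    obtain ⟨_, c, hc, hac⟩ := h
    exact ⟨hX', c, Set.union_subset_union_left _ hs hc, hac⟩
  ent_left {i X X' b} hX hX' _ h := by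
    obtain ⟨_, c, hc, hac⟩ := h
    exact ⟨hX, i, Or.inr rfl,
      Approximates.mono le_rfl hac (f.scott.monotone (le_of_basisCon hX' hc))⟩
  transfer {i j X b} hij hX h := by
    obtain ⟨_, c, hc, hac⟩ := h
    exact ⟨D.frame.consistency_transfer hij hX, j, Or.inr rfl, Approximates.mono le_rfl hac
      (f.scott.monotone ((le_of_basisCon hX hc).trans (le_of_basisCon hij (Or.inl rfl))))⟩
  interpolation {i X F} hX hF h := by
    have hFi : ∀ a ∈ Subtype.val '' F, Approximates a (f.toFun i.1) := by
      rintro _ ⟨a, ha, rfl⟩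
      obtain ⟨hX, c, hc, hac⟩ := h a ha
      exact Approximates.mono le_rfl hac (f.scott.monotone (le_of_basisCon hX hc))
    obtain ⟨e, heB, hei, hFe⟩ := approximates_image E.isBasis E.isBasis
      scottContinuous_identity (hF.image Subtype.val) hFi
    obtain ⟨d, hdB, hdi, hed⟩ := approximates_image (F := {e}) D.isBasis
      E.isBasis f.scott (Set.finite_singleton e) (by rintro _ rfl; exact hei)
    refine ⟨⟨d, hdB⟩, ⟨e, heB⟩, {⟨d, hdB⟩}, Or.inl rfl, {⟨e, heB⟩}, Or.inl rfl, ?_, ?_, ?_⟩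
    · rintro b (rfl | rfl) <;> exact ⟨hX, i, Or.inr rfl, hdi⟩
    · rintro b (rfl | rfl) <;> exact ⟨Or.inl rfl, ⟨d, hdB⟩, Or.inr rfl, hed e rfl⟩
    · intro b hb
      exact ⟨Or.inl rfl, ⟨e, heB⟩, Or.inr rfl, hFe b.1 ⟨b, hb, rfl⟩⟩

end BasedDOM

/-- The basis-to-frame functor `ℱ`. -/
def frameFunctor : BasedDOM.{u} ⥤ INF.{u} where
  obj D := D.frame
  map f := BasedDOM.frameMap f
  map_id D := rfl
  map_comp {D E K} f g := by
    apply ApproximableMapping.ext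
    funext i X a
    apply propext
    constructor
    · rintro ⟨hX, c, hc, hac⟩
      obtain ⟨e, heB, hec, hae⟩ := approximates_image (F := {a.1}) E.isBasis K.isBasis g.scott (Set.finite_singleton a.1) (by rintro _ rfl; exact hac)
      refine ⟨hX, ⟨e, heB⟩, {⟨e, heB⟩}, Or.inl rfl, ?_, Or.inl rfl, ⟨e, heB⟩, Or.inr rfl,
        hae a.1 rfl⟩
      rintro b (rfl | rfl) <;> exact ⟨hX, c, hc, hec⟩
    · rintro ⟨hX, e, V, hV, h1, _, v, hv, hav⟩
      obtain ⟨_, c, hc, hvc⟩ := h1 v (Set.union_comm V {e} ▸ hv)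
      exact ⟨hX, c, hc, Approximates.mono le_rfl hav (g.scott.monotone hvc.le)⟩

/-! Both functors being available, the equivalence amounts to two natural isomorphisms. On the frame
side, fix any basis `B` of `|A|`. The mapping `X η_i v ↔ v ≪ [X]_i` has as inverse the mapping that
relates `V` at the index `w` to exactly the tokens `a ∈ w`. Two facts translate between tokens and
approximation. A finite set of tokens of a state `z` already lies in some `c ∈ B` with `c ≪ z`
(`IsDomainBasis.exists_approximating`), since `z` is a directed union of its approximants in `B`.
Conversely `w ≪ z` factors as `w ≪ [X]_i` with `{i} ∪ X ⊆ z` (`exists_approximates_basicState`),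
since `z` is also the directed union of such `[X]_i`. The two composites are then identities, and
both sides of the naturality square say `a ≪ 𝒟(H)([X]_i)`. On the domain side, `x ↦ {a ∈ B | a ≪ x}`
is an order isomorphism onto the states of `ℱ(D)`: a state is a directed set of basis elements, and
it consists precisely of the basis elements approximating its supremum. Naturality is the fact that
`a ≪ f(x)` holds iff `a ≪ f(d)` for some basis element `d ≪ x` (`approximates_image`). The basis of
`|A|` is arbitrary throughout and morphisms ignore bases, so the same isomorphisms serve designated,
canonical and chosen bases. -/

theorem IsDomainBasis.exists_approximating {A : InformationFrame.{u}} {B : Set A.State}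
    (hB : IsDomainBasis B) (z : A.State) {F : Set A.carrier} (hF : F.Finite) (h : F ⊆ z.1) :
    ∃ c ∈ B, Approximates c z ∧ F ⊆ c.1 := by
  obtain ⟨S, hSB, hne, hd, hS⟩ := hB z
  obtain ⟨c, hc, hFc⟩ := InformationFrame.finite_subset_of_directed hne hd hF
    (fun a ha => InformationFrame.mem_of_isLUB hne hd hS (h ha))
  exact ⟨c, (hSB hc).1, (hSB hc).2, hFc⟩

/-! ### Approximation in the domain of states -/

namespace InformationFrame

variable {A A' : InformationFrame.{u}}

theorem basicState_le {i : A.carrier} {X : Set A.carrier} (hX : X ∈ A.Con i) {z : A.State}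
    (h : {i} ∪ X ⊆ z.1) : A.basicState i X hX ≤ z :=
  (approximates_of_subset hX h).le

/-- A state is the directed union of the basic states whose data it contains. -/
theorem isLUB_basicState (z : A.State) :
    let S : Set A.State :=
      {w | ∃ i, ∃ X, ∃ hX : X ∈ A.Con i, {i} ∪ X ⊆ z.1 ∧ w = A.basicState i X hX}
    S.Nonempty ∧ DirectedOn (· ≤ ·) S ∧ IsLUB S z := by
  refine ⟨?_, ?_, ?_, ?_⟩
  -- Consistency of the empty set is what makes a state nonempty.
  · obtain ⟨i, hi, hc⟩ := z.2.finite_consistency ∅ Set.finite_empty (Set.empty_subset _)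
    exact ⟨_, i, ∅, hc, by simpa using hi, rfl⟩
  · rintro _ ⟨i, X, hX, hz, rfl⟩ _ ⟨j, Y, hY, hz', rfl⟩
    obtain ⟨k, hk, Z, hZ, hZz, hE⟩ := z.2.entails
      (((Set.finite_singleton i).union (A.con_finite hX)).union
        ((Set.finite_singleton j).union (A.con_finite hY))) (Set.union_subset hz hz')
    exact ⟨_, ⟨k, Z, hZ, Set.union_subset (Set.singleton_subset_iff.2 hk) hZz, rfl⟩,
      basicState_le hX fun b hb => hE b (Or.inl hb), basicState_le hY fun b hb => hE b (Or.inr hb)⟩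
  · rintro _ ⟨i, X, hX, hz, rfl⟩
    exact basicState_le hX hz
  · intro w hw a ha
    obtain ⟨i, hi, X, _, hXz, hX, hE⟩ := z.2.complete a ha
    exact hw ⟨i, X, hX, Set.union_subset (Set.singleton_subset_iff.2 hi) hXz, rfl⟩ hE

/-- Approximation in the domain of states factors through a basic state whose data lie in the
larger state. -/
theorem exists_approximates_basicState {w z : A.State} (h : Approximates w z) :
    ∃ i, ∃ X, ∃ hX : X ∈ A.Con i, {i} ∪ X ⊆ z.1 ∧ Approximates w (A.basicState i X hX) := by
  -- The relation `w ≪ z` alone only puts `w` below a basic state. Interpolating `w ≪ v ≪ z` puts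
  -- `v` below one, so that `w` approximates it.
  obtain ⟨v, _, hwv, hvz⟩ := h.interpolate A.isDomainBasis_canonicalBasis
  obtain ⟨hne, hd, hz⟩ := isLUB_basicState z
  obtain ⟨_, ⟨i, X, hX, hXz, rfl⟩, hv⟩ := hvz _ hne hd z hz le_rfl
  exact ⟨i, X, hX, hXz, Approximates.mono le_rfl hwv hv⟩

/-- The domain of states with an arbitrary basis. -/
def stateDomainWith (A : InformationFrame.{u}) (B : Set A.State) (hB : IsDomainBasis B) :
    BasedDOM.{u} :=
  ⟨A.stateDomain.toDOM, B, hB⟩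

/-! ### The isomorphism between a frame and the frame of its states -/

variable {B : Set A.State} {hB : IsDomainBasis B} {B' : Set A'.State} {hB' : IsDomainBasis B'}

/-- The approximable mapping from an information frame to the frame of its domain of states. -/
def toStateFrame (A : InformationFrame.{u}) (B : Set A.State) (hB : IsDomainBasis B) :
    ApproximableMapping A (A.stateDomainWith B hB).frame where
  rel i X v := ∃ hX : X ∈ A.Con i,
    Approximates (D := A.State) (Subtype.val v) (A.basicState i X hX)
  con_of_rel h := h.1
  ent_right {i X k Y b} hX h hY := by
    obtain ⟨_, c, hc, hbc⟩ := hY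
    obtain ⟨_, hcX⟩ := h c (Set.union_comm Y {k} ▸ hc)
    exact ⟨hX, Approximates.mono le_rfl hbc hcX.le⟩
  weakening hX hX' hs h := ⟨hX', Approximates.mono le_rfl h.2
    (show A.basicState _ _ hX ≤ _ from fun _ ha => A.weakening hX hX' hs ha)⟩
  ent_left hX hX' hs h := ⟨hX, Approximates.mono le_rfl h.2
    (show A.basicState _ _ hX' ≤ _ from fun _ ha => A.cut hX hs ha)⟩
  transfer hij hX h := ⟨A.consistency_transfer hij hX, Approximates.mono le_rfl h.2
    (show A.basicState _ _ hX ≤ _ from fun _ ha => A.entailment_transfer hij hX ha)⟩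
  interpolation {i X F} hX hF h := by
    -- Two interpolations: first `F ≪ e ≪ [X]_i` with `e ∈ B`, then `e ≪ [U]_c` with `{c} ∪ U ⊆
    -- [X]_i`. The singleton `{e}` serves as the right-hand witness set.
    obtain ⟨e, heB, hei, hFe⟩ := approximates_image hB hB
      scottContinuous_identity (x := A.basicState i X hX) (hF.image Subtype.val) (by
        rintro _ ⟨a, ha, rfl⟩
        exact (h a ha).2)
    obtain ⟨c, U, hU, hUX, heU⟩ := exists_approximates_basicState hei
    refine ⟨c, ⟨e, heB⟩, U, hU, {⟨e, heB⟩}, Or.inl rfl, fun b hb => hUX hb, ?_, ?_⟩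
    · rintro b (rfl | rfl) <;> exact ⟨hU, heU⟩
    · intro b hb
      exact ⟨Or.inl rfl, ⟨e, heB⟩, Or.inr rfl, hFe b.1 ⟨b, hb, rfl⟩⟩

/-- The approximable mapping from the frame of the domain of states back to the information
frame. -/
def ofStateFrame (A : InformationFrame.{u}) (B : Set A.State) (hB : IsDomainBasis B) :
    ApproximableMapping (A.stateDomainWith B hB).frame A where
  -- All members of `V` lie below `w`, so `V` contributes no tokens beyond those of `w`.
  rel w V a := V ∈ (A.stateDomainWith B hB).basisCon w ∧ a ∈ (show A.State from w.1).1
  con_of_rel h := h.1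
  ent_right {w V k Y b} hV h hY :=
    ⟨hV, (show A.State from w.1).2.closed k (h k (Or.inl rfl)).2 Y
      (A.con_finite (A.con_of_ent hY)) (fun c hc => (h c (Or.inr hc)).2) b (A.con_of_ent hY) hY⟩
  weakening _ hV' _ h := ⟨hV', h.2⟩
  ent_left hV _ _ h := ⟨hV, h.2⟩
  transfer hij hV h := ⟨(A.stateDomainWith B hB).frame.consistency_transfer hij hV,
    BasedDOM.le_of_basisCon hij (Or.inl rfl) h.2⟩
  interpolation {w V F} hV hF h := by
    -- A single consistent set inside `w` entails all of `F`; its finitely many tokens, with their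
    -- index, then already lie in one basis element `c ≪ w`.
    obtain ⟨e, he, Y, hY, hYw, hE⟩ := (show A.State from w.1).2.entails hF (fun a ha => (h a ha).2)
    obtain ⟨c, hcB, hcw, hYc⟩ := hB.exists_approximating (show A.State from w.1)
      ((Set.finite_singleton e).union (A.con_finite hY))
      (Set.union_subset (Set.singleton_subset_iff.2 he) hYw)
    refine ⟨⟨c, hcB⟩, e, {⟨c, hcB⟩}, Or.inl rfl, Y, hY, ?_, fun b hb => ⟨Or.inl rfl, hYc hb⟩, hE⟩
    rintro b (rfl | rfl) <;> exact ⟨hV, w, Or.inr rfl, hcw⟩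

/-- The composite asks for `a` to lie in some `v ∈ B` with `v ≪ [X]_i`. These `v` exhaust `[X]_i`,
so this is `X ⊢_i a`. -/
theorem toStateFrame_compose_ofStateFrame (A : InformationFrame.{u}) (B : Set A.State)
    (hB : IsDomainBasis B) :
    (A.toStateFrame B hB).compose (A.ofStateFrame B hB) = ApproximableMapping.identity A := by
  apply ApproximableMapping.ext
  funext i X a
  apply propext
  constructor
  · rintro ⟨hX, v, V, hV, h, _, ha⟩
    exact (h v (Or.inl rfl)).2.le ha
  · intro h
    have hX := A.con_of_ent h
    obtain ⟨v, hvB, hv, hav⟩ := hB.exists_approximating (A.basicState i X hX)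
      (Set.finite_singleton a) (Set.singleton_subset_iff.2 h)
    refine ⟨hX, ⟨v, hvB⟩, {⟨v, hvB⟩}, Or.inl rfl, ?_, Or.inl rfl, hav rfl⟩
    rintro b (rfl | rfl) <;> exact ⟨hX, hv⟩

/-- The composite asks for `v ≪ [U]_e` with `{e} ∪ U ⊆ w`, which amounts to `v ≪ w`. Entailment in
the frame amounts to the same, since every member of `V ∪ {w}` is below `w`. -/
theorem ofStateFrame_compose_toStateFrame (A : InformationFrame.{u}) (B : Set A.State)
    (hB : IsDomainBasis B) :
    (A.ofStateFrame B hB).compose (A.toStateFrame B hB) =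
      ApproximableMapping.identity (A.stateDomainWith B hB).frame := by
  apply ApproximableMapping.ext
  funext w V v
  apply propext
  constructor
  · rintro ⟨hV, e, U, hU, h, _, hv⟩
    exact ⟨hV, w, Or.inr rfl, Approximates.mono le_rfl hv (basicState_le hU fun b hb => (h b hb).2)⟩
  · rintro ⟨hV, c, hc, hvc⟩
    obtain ⟨e, U, hU, hUc, hv⟩ := exists_approximates_basicState hvc
    exact ⟨hV, e, U, hU, fun b hb => ⟨hV, BasedDOM.le_of_basisCon hV hc (hUc hb)⟩, hU, hv⟩

/-- Both composites say that `a` approximates the image of `[X]_i` under `H.stateMap`, which is the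
set of all `b` with `X H_i b`. The left one factors the approximation through a basic state of `A'`,
the right one through a basis element approximating `[X]_i`. -/
theorem toStateFrame_naturality (H : ApproximableMapping A A') :
    H.compose (A'.toStateFrame B' hB') =
      (A.toStateFrame B hB).compose (BasedDOM.frameMap (D := A.stateDomainWith B hB)
        (E := A'.stateDomainWith B' hB') H.stateMap) := by
  apply ApproximableMapping.ext
  funext i X a
  apply propext
  constructor
  · rintro ⟨hX, e, V, hV, h, _, ha⟩
    have hle : A'.basicState e V hV ≤ H.stateMap.toFun (A.basicState i X hX) :=
      basicState_le hV fun b hb => by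
        obtain ⟨c, U, hU, hUX, hr⟩ := H.interp_left (F := {b}) hX (Set.finite_singleton b)
          (by rintro _ rfl; exact h _ hb)
        exact ⟨c, U, hU, hUX, hr b rfl⟩
    obtain ⟨v, hvB, hv, hav⟩ := approximates_image (F := {a.1}) hB hB' H.stateMap.scott
      (Set.finite_singleton _) (by rintro _ rfl; exact ha.mono le_rfl hle)
    refine ⟨hX, ⟨v, hvB⟩, {⟨v, hvB⟩}, Or.inl rfl, ?_, Or.inl rfl, ⟨v, hvB⟩, Or.inr rfl,
      hav _ rfl⟩
    rintro b (rfl | rfl) <;> exact ⟨hX, hv⟩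
  · rintro ⟨hX, v, V, hV, h, _, c, hc, hac⟩
    obtain ⟨_, hcX⟩ := h c (Set.union_comm V {v} ▸ hc)
    -- Since `c ≤ [X]_i`, monotonicity moves the approximation from the image of `c` to that of
    -- `[X]_i`, where it factors through some `[U]_e`.
    obtain ⟨e, U, hU, hUc, ha⟩ := exists_approximates_basicState
      (Approximates.mono le_rfl hac (H.stateMap.scott.monotone hcX.le))
    refine ⟨hX, e, U, hU, fun b hb => ?_, hU, ha⟩
    obtain ⟨j, Y, _, hYX, hr⟩ := hUc hb
    exact H.strong_left hX (fun d hd => hYX hd) hr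

/-- An information frame is isomorphic to the frame of its domain of states, for any basis. -/
def stateFrameIso (A : INF.{u}) (B : Set A.State) (hB : IsDomainBasis B) :
    A ≅ ((A.stateDomainWith B hB).frame : INF.{u}) where
  hom := A.toStateFrame B hB
  inv := A.ofStateFrame B hB
  hom_inv_id := A.toStateFrame_compose_ofStateFrame B hB
  inv_hom_id := A.ofStateFrame_compose_toStateFrame B hB

end InformationFrame

/-! ### The isomorphism between a domain and the states of its frame -/

namespace BasedDOM

/-- The state of all basis elements approximating a point. -/
def approximants (D : BasedDOM.{u}) (x : D.toDOM.carrier) : D.frame.State where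
  val := {a : D.basis | Approximates a.1 x}
  property :=
    { finite_consistency := fun F hF h => by
        obtain ⟨e, heB, hex, hFe⟩ := approximates_image D.isBasis D.isBasis
          scottContinuous_identity (x := x) (hF.image Subtype.val) (by
            rintro _ ⟨a, ha, rfl⟩
            exact h ha)
        exact ⟨⟨e, heB⟩, hex, Or.inr ⟨hF, fun b hb => hFe b.1 ⟨b, hb, rfl⟩⟩⟩
      closed := fun i hi X _ _ a hX hE => by
        obtain ⟨_, c, hc, hac⟩ := hE
        exact Approximates.mono le_rfl hac ((le_of_basisCon hX hc).trans hi.le)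
      complete := fun a ha => by
        obtain ⟨i, hiB, hai, hix⟩ := Approximates.interpolate D.isBasis ha
        exact ⟨⟨i, hiB⟩, hix, {⟨i, hiB⟩}, Set.finite_singleton _,
          Set.singleton_subset_iff.2 hix, Or.inl rfl, Or.inl rfl, ⟨i, hiB⟩, Or.inr rfl, hai⟩ }

/-- A point is recovered as the supremum of a set of its basis approximants, so inclusion of
approximants reflects the order. -/
theorem approximants_le_iff (D : BasedDOM.{u}) {x y : D.toDOM.carrier} :
    D.approximants x ≤ D.approximants y ↔ x ≤ y := by
  constructor
  · intro h
    obtain ⟨S, hSB, _, _, hS⟩ := D.isBasis x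
    exact hS.2 fun b hb => (h (show (⟨b, (hSB hb).1⟩ : D.basis) ∈ _ from (hSB hb).2)).le
  · exact fun h a ha => Approximates.mono le_rfl ha h

/-- The preimage of a state is its supremum in `D`, which exists because consistency makes states
directed. -/
theorem approximants_surjective (D : BasedDOM.{u}) : Function.Surjective D.approximants := by
  intro s
  have hne : (Subtype.val '' s.1).Nonempty := by
    obtain ⟨i, hi, _⟩ := s.2.finite_consistency ∅ Set.finite_empty (Set.empty_subset _)
    exact ⟨_, i, hi, rfl⟩
  have hd : DirectedOn (· ≤ ·) (Subtype.val '' s.1) := by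
    rintro _ ⟨a, ha, rfl⟩ _ ⟨b, hb, rfl⟩
    -- Consistency of `{a, b}` at `i` forces `a ≤ i` and `b ≤ i`, so the index is the required upper
    -- bound in `s`.
    obtain ⟨i, hi, hc⟩ := s.2.finite_consistency {a, b} ((Set.finite_singleton b).insert a)
      (Set.insert_subset ha (Set.singleton_subset_iff.2 hb))
    exact ⟨i.1, ⟨i, hi, rfl⟩, le_of_basisCon hc (Or.inl (Or.inl rfl)),
      le_of_basisCon hc (Or.inl (Or.inr rfl))⟩
  obtain ⟨x, hx⟩ := D.toDOM.directedComplete _ hne hd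
  refine ⟨x, Subtype.ext (Set.Subset.antisymm ?_ ?_)⟩
  · intro a ha
    -- Closure of `s` needs `a ≪ w` for some `w ∈ s`, whereas `a ≪ x` gives only `a ≤ w`; the
    -- interpolant `b` restores the strict relation.
    obtain ⟨b, hbB, hab, hbx⟩ := Approximates.interpolate D.isBasis ha
    obtain ⟨_, ⟨w, hw, rfl⟩, hbw⟩ := hbx _ hne hd x hx le_rfl
    exact s.2.closed w hw {w} (Set.finite_singleton w) (Set.singleton_subset_iff.2 hw) a
      (Or.inl rfl) ⟨Or.inl rfl, w, Or.inr rfl, Approximates.mono le_rfl hab hbw⟩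
  · intro a ha
    obtain ⟨i, hi, X, _, hXs, _, _, c, hc, hac⟩ := s.2.complete a ha
    refine Approximates.mono le_rfl hac (hx.1 ⟨c, ?_, rfl⟩)
    rcases hc with hc | rfl
    · exact hXs hc
    · exact hi

/-- A domain is order isomorphic to the domain of states of its frame. -/
noncomputable def approximantsOrderIso (D : BasedDOM.{u}) :
    D.toDOM.carrier ≃o D.frame.State :=
  RelIso.ofSurjective (OrderEmbedding.ofMapLEIff D.approximants fun _ _ => D.approximants_le_iff)
    D.approximants_surjective

/-- The isomorphism of based domains induced by an order isomorphism. -/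
def isoOfOrderIso {D E : BasedDOM.{u}} (e : D.toDOM.carrier ≃o E.toDOM.carrier) : D ≅ E where
  hom := ⟨e, fun _ _ _ _ ha => e.isLUB_image'.2 ha⟩
  inv := ⟨e.symm, fun _ _ _ _ ha => e.symm.isLUB_image'.2 ha⟩
  hom_inv_id := ScottMap.ext (funext e.symm_apply_apply)
  inv_hom_id := ScottMap.ext (funext e.apply_symm_apply)

/-- Scott continuity gives `a ≪ f(x)` exactly when `a ≪ f(d)` for some basis element `d ≪ x`; the
right-hand state is made of such `a`. -/
theorem approximants_naturality {D E : BasedDOM.{u}} (f : ScottMap D.toDOM E.toDOM)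
    (x : D.toDOM.carrier) :
    E.approximants (f.toFun x) = (frameMap f).stateMap.toFun (D.approximants x) := by
  apply Subtype.ext
  apply Set.Subset.antisymm
  · intro a ha
    obtain ⟨d, hdB, hdx, had⟩ := approximates_image (F := {a.1}) D.isBasis E.isBasis f.scott
      (Set.finite_singleton _) (by rintro _ rfl; exact ha)
    refine ⟨⟨d, hdB⟩, {⟨d, hdB⟩}, Or.inl rfl, ?_, Or.inl rfl, ⟨d, hdB⟩, Or.inr rfl, had _ rfl⟩
    rintro b (rfl | rfl) <;> exact hdx
  · rintro a ⟨i, X, _, hXx, _, c, hc, hac⟩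
    exact Approximates.mono le_rfl hac
      (f.scott.monotone (Approximates.le (hXx (Set.union_comm X {i} ▸ hc))))

/-- The natural isomorphism sending a point of a domain to the state of its approximants. -/
noncomputable def unitIso : 𝟭 BasedDOM.{u} ≅ frameFunctor ⋙ stateFunctor :=
  NatIso.ofComponents
    (fun D => isoOfOrderIso (E := D.frame.stateDomain) D.approximantsOrderIso)
    (fun f => ScottMap.ext (funext (approximants_naturality f)))

end BasedDOM

/-- The natural isomorphism from an information frame to the frame of its domain of states. -/
def frameCounitIso : 𝟭 INF.{u} ≅ stateFunctor ⋙ frameFunctor :=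
  NatIso.ofComponents
    (fun A => A.stateFrameIso A.canonicalBasis A.isDomainBasis_canonicalBasis)
    (fun H => InformationFrame.toStateFrame_naturality H)

/-! ### Chosen bases and the equivalences -/

namespace BasisChoice

variable (𝓑 : BasisChoice.{u})

/-- The natural isomorphism from an information frame to the frame of its domain of states, formed
with chosen bases. -/
def counitIso :
    𝟭 INF.{u} ≅ (stateFunctor ⋙ BasedDOM.forgetBasis) ⋙ (𝓑.equip ⋙ frameFunctor) :=
  NatIso.ofComponents
    (fun A => A.stateFrameIso (𝓑.basis A.stateDomain.toDOM) (𝓑.isBasis A.stateDomain.toDOM))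
    (fun H => InformationFrame.toStateFrame_naturality H)

/-- The natural isomorphism sending a point of a domain to the state of its approximants in the
chosen basis. -/
noncomputable def unitIso :
    𝟭 DOM.{u} ≅ (𝓑.equip ⋙ frameFunctor) ⋙ (stateFunctor ⋙ BasedDOM.forgetBasis) :=
  NatIso.ofComponents
    -- The isomorphism for `D` with its chosen basis lands in a state domain with its canonical
    -- basis; forgetting both bases leaves the same Scott continuous map.
    (fun D => BasedDOM.forgetBasis.mapIso (BasedDOM.unitIso.app (𝓑.equip.obj D)))
    (fun f => BasedDOM.unitIso.hom.naturality (𝓑.equip.map f))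

/-- The equivalence between domains and information frames formed with chosen bases. -/
noncomputable def equivalence : DOM.{u} ≌ INF.{u} :=
  -- Two natural isomorphisms suffice: the triangle identity is obtained by adjusting one of them,
  -- so it need not be checked for these.
  CategoryTheory.Equivalence.mk (𝓑.equip ⋙ frameFunctor) (stateFunctor ⋙ BasedDOM.forgetBasis)
    𝓑.unitIso 𝓑.counitIso.symm

/-- Every domain has a basis, so a choice of bases exists. -/
noncomputable def default : BasisChoice.{u} where
  basis D := D.exists_basis.choose
  isBasis D := D.exists_basis.choose_spec

end BasisChoice

theorem mainTheorem1 :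
    -- the categories are equivalent
    Nonempty (DOM.{u} ≌ INF.{u}) ∧
    -- the equivalence for domains with designated bases, where `|A|` carries its canonical basis
    ((∃ e : BasedDOM.{u} ≌ INF.{u}, e.functor = frameFunctor ∧ e.inverse = stateFunctor) ∧
      (∃ η : 𝟭 INF.{u} ≅ stateFunctor ⋙ frameFunctor,
        ∀ (A : INF.{u}) (i : A.carrier) (X : Set A.carrier) (v : A.canonicalBasis),
          ApproximableMapping.rel (η.hom.app A) i X v ↔
            ∃ hX : X ∈ A.Con i, Approximates v.1 (A.basicState i X hX)) ∧
      (∃ τ : 𝟭 BasedDOM.{u} ≅ frameFunctor ⋙ stateFunctor,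
        ∀ (D : BasedDOM.{u}) (x : D.toDOM.carrier),
          (ScottMap.toFun (τ.hom.app D) x : D.frame.State).1 = {a | Approximates a.1 x})) ∧
    -- the equivalence for plain domains, where the frames are formed from an arbitrary choice
    -- of a basis of every domain
    (∀ 𝓑 : BasisChoice.{u},
      (∃ e : DOM.{u} ≌ INF.{u},
        e.functor = 𝓑.equip ⋙ frameFunctor ∧ e.inverse = stateFunctor ⋙ BasedDOM.forgetBasis) ∧
      (∃ η : 𝟭 INF.{u} ≅ (stateFunctor ⋙ BasedDOM.forgetBasis) ⋙ (𝓑.equip ⋙ frameFunctor),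
        ∀ (A : INF.{u}) (i : A.carrier) (X : Set A.carrier)
          (v : 𝓑.basis A.stateDomain.toDOM),
          ApproximableMapping.rel (η.hom.app A) i X v ↔
            ∃ hX : X ∈ A.Con i,
              Approximates v.1 (A.basicState i X hX : A.stateDomain.toDOM.carrier)) ∧
      (∃ τ : 𝟭 DOM.{u} ≅ (𝓑.equip ⋙ frameFunctor) ⋙ (stateFunctor ⋙ BasedDOM.forgetBasis),
        ∀ (D : DOM.{u}) (x : D.carrier),
          (ScottMap.toFun (τ.hom.app D) x : (𝓑.equip.obj D).frame.State).1 =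
            {a | Approximates a.1 x})) := by
  -- The formulas for `η` and `τ` hold by definition of the components.
  refine ⟨⟨BasisChoice.default.equivalence⟩, ⟨?_, ⟨frameCounitIso, fun _ _ _ _ => Iff.rfl⟩,
    ⟨BasedDOM.unitIso, fun _ _ => rfl⟩⟩, fun 𝓑 => ⟨⟨𝓑.equivalence, rfl, rfl⟩,
    ⟨𝓑.counitIso, fun _ _ _ _ => Iff.rfl⟩, ⟨𝓑.unitIso, fun _ _ => rfl⟩⟩⟩
  exact ⟨CategoryTheory.Equivalence.mk frameFunctor stateFunctor BasedDOM.unitIso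
    frameCounitIso.symm, rfl, rfl⟩
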